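/- Let $N\ge 1$, $\operatorname{Im}\tau>0$, let $\vartheta(z)=-\sum_{m\in\mathbb Z}\exp\big(\pi i\tau(m+\tfrac12)^2+2\pi i(m+\tfrac12)(z+\tfrac12)\big)$ be the odd Jacobi theta function (its zeros are $\mathbb Z+\tau\mathbb Z$), and put $\phi(z,u)=\frac{\vartheta'(0)\vartheta(z+u)}{\vartheta(z)\vartheta(u)}$, $E_1(u)=\vartheta'(u)/\vartheta(u)$. Let $\varepsilon\in\mathbb R$, $\nu\in\mathbb C$. The phase space consists of the continuous $2\pi$-periodic complex fields $p_i(x),q_i(x)$, $i=1,\dots,N$, with the canonical bracket $\{p_i(x),q_j(y)\}=\delta_{ij}\delta(x-y)$, $\{p_i(x),p_j(y)\}=\{q_i(x),q_j(y)\}=0$, that is, $\{F,G\}=\sum_i\int_0^{2\pi}\big(\frac{\delta F}{\delta p_i(x)}\frac{\delta G}{\delta q_i(x)}-\frac{\delta F}{\delta q_i(x)}\frac{\delta G}{\delta p_i(x)}\big)dx$. Put $q_{ij}^\varepsilon(x)=q_i(x-\varepsilon)-q_j(x)-\nu\varepsilon$ and let $U(z,x)$ be the $N\times N$ matrix $$U_{ij}(z,x)=\phi\big(z,q_{ij}^\varepsilon(x)\big)\,\frac{\prod_{a=1}^N\vartheta(q_j(x)-q_a(x-\varepsilon)+\nu\varepsilon)}{\vartheta(\nu\varepsilon)\prod_{a\ne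 j}\vartheta(q_j(x)-q_a(x))}\,e^{-\varepsilon p_j(x)} .$$ Fix a field configuration and $z,w\in\mathbb C$ such that $\nu\varepsilon$, $z$, $w$, $z-w$, all $q_i(x)-q_j(x)$ with $i\ne j$, and all $q_{ij}^\varepsilon(x)$ (every $x$) lie outside $\mathbb Z+\tau\mathbb Z$. With matrix units $E_{ij}$, $U_1=U\otimes 1$ and $U_2=1\otimes U$, let $$r_{12}(\zeta|x)=\sum_{i\ne j}\phi(\zeta,q_i(x)-q_j(x))E_{ij}\otimes E_{ji}+E_1(\zeta)\sum_iE_{ii}\otimes E_{ii}-\sum_{i\neq j}E_1(q_i(x)-q_j(x))E_{ii}\otimes E_{jj},$$ $$s^+_{12}(z,x)=s_{12}(z,x)+u^+_{12}(x),\quad s^-_{12}(w,x)=s_{21}(w,x)+u^-_{12}(x),$$ $$u^+_{12}(x)=\sum_{i,j}E_1(q_{ji}^\varepsilon(x))E_{ii}\otimes E_{jj},\quad u^-_{12}(x)=\sum_{i,j}E_1(q_{ij}^\varepsilon(x))E_{ii}\otimes E_{jj},$$ where $s_{12}$, $s_{21}$ are defined by $$U_1(z,x)s_{12}(z,x)=\sum_{i,j}U_{ij}(z,x)\big(E_1(z+q_{ij}^\varepsilon(x))-E_1(q_{ij}^\varepsilon(x))\big)E_{ij}\otimes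 E_{ii},$$ $$U_2(w,x)s_{21}(w,x)=\sum_{i,j}U_{ij}(w,x)\big(E_1(w+q_{ij}^\varepsilon(x))-E_1(q_{ij}^\varepsilon(x))\big)E_{ii}\otimes E_{ij}$$ (where $z+q^\varepsilon_{ij}(x)\in\mathbb Z+\tau\mathbb Z$ the factor $\phi(z,u)(E_1(z+u)-E_1(u))$ is read as its continuous extension $\partial_u\phi(z,u)$). If $U(z,x)$ and $U(w,x)$ are invertible for all $x$, so that $s_{12}(z,x)$ and $s_{21}(w,x)$ exist, then, as an identity of distributions in $(x,y)$ on the torus, $$\begin{aligned}\{U_1(z,x),U_2(w,y)\}={}&-\varepsilon\delta(x-y)\Big(U_1(z,x)U_2(w,x)r_{12}(z-w|x)-r_{12}(z-w|x-\varepsilon)U_1(z,x)U_2(w,x)\\&\quad+U_1(z,x)s^+_{12}(z,x)U_2(w,x)-U_2(w,x)s^-_{12}(w,x)U_1(z,x)\Big)\\&-\varepsilon\delta(x-y+\varepsilon)U_1(z,x)U_2(w,y)s^-_{12}(w,y)+\varepsilon\delta(x-y-\varepsilon)U_1(z,x)U_2(w,y)s^+_{12}(z,x).\end{aligned}$$ Here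 $\{U_1(z,x),U_2(w,y)\}=\sum_{i,j,k,l}E_{ij}\otimes E_{kl}\{U_{ij}(z,x),U_{kl}(w,y)\}$, and the identity means that for all continuous $2\pi$-periodic test functions $f,g$ and all $i,j,k,l$ the functionals $\int fU_{ij}(z,\cdot)\,dx$ and $\int gU_{kl}(w,\cdot)\,dy$ have functional derivatives at the given configuration, and their bracket equals the pairing of the $E_{ij}\otimes E_{kl}$ component of the right side with $f(x)g(y)$. Without the invertibility assumption the same identity holds if the products $U_1(z,x)s_{12}(z,x)$ and $U_2(w,x)s_{21}(w,x)$ are replaced by the right sides of their defining equations (in the last term one uses $U_1(z,x)U_2(w,y)=U_2(w,y)U_1(z,x)$). -/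

import Mathlib

open Complex MeasureTheory
open scoped Kronecker Matrix

noncomputable section

/- ### Elliptic functions -/

/-- Theta function with characteristics `a`, `b`. -/
def thetaChar (a b z τ : ℂ) : ℂ :=
  ∑' j : ℤ, exp (2 * Real.pi * I * ((j : ℂ) + a) ^ 2 * (τ / 2)
    + 2 * Real.pi * I * ((j : ℂ) + a) * (z + b))

/-- The odd Jacobi theta function. Its zeros are exactly the points of `ℤ + τℤ`. -/
def theta (τ z : ℂ) : ℂ := -thetaChar (1 / 2) (1 / 2) z τ

/-- The elliptic Kronecker function. -/
def phi (τ z u : ℂ) : ℂ :=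
  deriv (theta τ) 0 * theta τ (z + u) / (theta τ z * theta τ u)

/-- The first Eisenstein function. -/
def E1 (τ u : ℂ) : ℂ := deriv (theta τ) u / theta τ u

theorem theta_eq_jacobiTheta₂ (τ z : ℂ) :
    theta τ z = -(exp (Real.pi * I * τ / 4 + Real.pi * I * (z + 1 / 2)) *
      jacobiTheta₂ (z + 1 / 2 + τ / 2) τ) := by
  rw [theta, thetaChar, jacobiTheta₂, ← tsum_mul_left]
  congr 1
  refine tsum_congr fun j => ?_
  rw [jacobiTheta₂_term, ← Complex.exp_add]
  congr 1
  ring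

theorem differentiable_theta {τ : ℂ} (hτ : 0 < τ.im) : Differentiable ℂ (theta τ) := by
  have h : theta τ = fun z => -(exp (Real.pi * I * τ / 4 + Real.pi * I * (z + 1 / 2)) *
      jacobiTheta₂ (z + 1 / 2 + τ / 2) τ) := funext (theta_eq_jacobiTheta₂ τ)
  rw [h]
  intro z
  have h2 : DifferentiableAt ℂ (fun z : ℂ => jacobiTheta₂ (z + 1 / 2 + τ / 2) τ) z :=
    DifferentiableAt.comp (f := fun z : ℂ => z + 1 / 2 + τ / 2) (g := fun y => jacobiTheta₂ y τ) z
      (differentiableAt_jacobiTheta₂_fst (z + 1 / 2 + τ / 2) hτ) (by fun_prop)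
  fun_prop

/-- `∂_u φ(z,u) = φ(z,u) (E₁(z+u) - E₁(u))`. The left side also makes sense at `z + u ∈ ℤ + τℤ`,
where the zero of `φ` cancels the pole of `E₁`. -/
theorem deriv_phi {τ : ℂ} (hτ : 0 < τ.im) {z u : ℂ}
    (hu : theta τ u ≠ 0) (hzu : theta τ (z + u) ≠ 0) :
    deriv (phi τ z) u = phi τ z u * (E1 τ (z + u) - E1 τ u) := by
  by_cases hz : theta τ z = 0
  · have : phi τ z = fun _ => 0 := by funext v; simp [phi, hz]
    simp [this]
  have hd := differentiable_theta hτ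
  have h1 : HasDerivAt (fun v => theta τ (z + v)) (deriv (theta τ) (z + u)) u :=
    HasDerivAt.comp_const_add z u (hd (z + u)).hasDerivAt
  have h2 := (h1.const_mul (deriv (theta τ) 0)).div
    ((hd u).hasDerivAt.const_mul (theta τ z)) (mul_ne_zero hz hu)
  rw [show deriv (phi τ z) u = _ from h2.deriv, phi, E1, E1]
  field_simp

/- ### Phase space and Poisson bracket of 1+1 field theory on the circle of length `2π` -/

instance factTwoPiPos : Fact (0 < 2 * Real.pi) := ⟨Real.two_pi_pos⟩

/-- The circle `ℝ / 2πℤ` (with its Lebesgue measure of total mass `2π`). -/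
abbrev Circ : Type := AddCircle (2 * Real.pi)

/-- Field configurations `P = (p, q)`: `N` momenta `p_i(x) = P.1 i x` and `N` positions
`q_i(x) = P.2 i x`, complex valued and `2π`-periodic. -/
abbrev PhaseSpace (N : ℕ) : Type := (Fin N → C(Circ, ℂ)) × (Fin N → C(Circ, ℂ))

/-- The functional `F` has at `P` the functional derivatives `δF/δp_i(x) = Dp i x` and
`δF/δq_i(x) = Dq i x`. -/
def HasFunctionalDeriv {N : ℕ} (F : PhaseSpace N → ℂ) (P : PhaseSpace N)
    (Dp Dq : Fin N → C(Circ, ℂ)) : Prop :=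
  ∀ h : PhaseSpace N, HasDerivAt (fun t : ℂ => F (P + t • h))
    (∑ i, ∫ x : Circ, (Dp i x * h.1 i x + Dq i x * h.2 i x)) 0

/-- `{F, G}(P) = v` for the canonical bracket
`{F, G} = ∑ᵢ ∫ (δF/δpᵢ(x) δG/δqᵢ(x) - δF/δqᵢ(x) δG/δpᵢ(x)) dx`, including the existence of the
functional derivatives. -/
def HasPoissonBracket {N : ℕ} (F G : PhaseSpace N → ℂ) (P : PhaseSpace N) (v : ℂ) : Prop :=
  ∃ Fp Fq Gp Gq : Fin N → C(Circ, ℂ),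
    HasFunctionalDeriv F P Fp Fq ∧ HasFunctionalDeriv G P Gp Gq ∧
      v = ∑ i, ∫ x : Circ, (Fp i x * Gq i x - Fq i x * Gp i x)

/-- The local field `A(x)` smeared with the test function `f`. -/
def smear {N : ℕ} (f : C(Circ, ℂ)) (A : PhaseSpace N → Circ → ℂ) (P : PhaseSpace N) : ℂ :=
  ∫ x : Circ, f x * A P x

theorem HasFunctionalDeriv.unique {N : ℕ} {F : PhaseSpace N → ℂ} {P : PhaseSpace N}
    {Dp Dq Dp' Dq' : Fin N → C(Circ, ℂ)} (h : HasFunctionalDeriv F P Dp Dq)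
    (h' : HasFunctionalDeriv F P Dp' Dq') : Dp = Dp' ∧ Dq = Dq' := by
  have key : ∀ u : C(Circ, ℂ), (∀ v : C(Circ, ℂ), ∫ x : Circ, u x * v x = 0) → u = 0 := by
    intro u hu
    have h1 := hu (star u)
    have h2 : ∀ x : Circ, u x * (star u) x = ((‖u x‖ ^ 2 : ℝ) : ℂ) := fun x => by
      simp [Complex.mul_conj, Complex.normSq_eq_norm_sq]
    simp_rw [h2] at h1
    have h3 : ∫ x : Circ, ‖u x‖ ^ 2 = 0 := by
      have h5 := integral_ofReal (μ := (volume : Measure Circ)) (𝕜 := ℂ) (f := fun x => ‖u x‖ ^ 2)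
      exact Complex.ofReal_eq_zero.mp (h5.symm.trans h1)
    have hc : Continuous fun x : Circ => ‖u x‖ ^ 2 := by fun_prop
    ext x
    by_contra hx
    have h4 := hc.integral_pos_of_hasCompactSupport_nonneg_nonzero (μ := volume) (x := x)
      (HasCompactSupport.of_compactSpace _) (fun x => by positivity) (by simpa using hx)
    exact h4.ne' h3
  have int : ∀ u v : C(Circ, ℂ), Integrable (fun x : Circ => u x * v x) := fun u v =>
    (by fun_prop : Continuous fun x : Circ => u x * v x).integrable_of_hasCompactSupport
      (HasCompactSupport.of_compactSpace _)
  constructor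
  · funext i
    rw [← sub_eq_zero]
    refine key _ fun v => ?_
    have e := (h (Pi.single i v, 0)).unique (h' (Pi.single i v, 0))
    simp only [Pi.zero_apply, ContinuousMap.zero_apply, mul_zero, add_zero] at e
    rw [Finset.sum_eq_single i, Finset.sum_eq_single i] at e
    · simp only [Pi.single_eq_same] at e
      simp only [ContinuousMap.sub_apply, sub_mul]
      rw [integral_sub (int _ _) (int _ _), e, sub_self]
    all_goals simp +contextual
  · funext i
    rw [← sub_eq_zero]
    refine key _ fun v => ?_
    have e := (h (0, Pi.single i v)).unique (h' (0, Pi.single i v))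
    simp only [Pi.zero_apply, ContinuousMap.zero_apply, mul_zero, zero_add] at e
    rw [Finset.sum_eq_single i, Finset.sum_eq_single i] at e
    · simp only [Pi.single_eq_same] at e
      simp only [ContinuousMap.sub_apply, sub_mul]
      rw [integral_sub (int _ _) (int _ _), e, sub_self]
    all_goals simp +contextual

/-- The value of the bracket is determined. -/
theorem HasPoissonBracket.unique {N : ℕ} {F G : PhaseSpace N → ℂ} {P : PhaseSpace N} {v v' : ℂ}
    (h : HasPoissonBracket F G P v) (h' : HasPoissonBracket F G P v') : v = v' := by
  obtain ⟨a, b, c, d, h1, h2, rfl⟩ := h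
  obtain ⟨a', b', c', d', h1', h2', rfl⟩ := h'
  obtain ⟨rfl, rfl⟩ := h1.unique h1'
  obtain ⟨rfl, rfl⟩ := h2.unique h2'
  rfl

/- ### Distributional brackets of matrix-valued fields -/

/-- Operators on `ℂ^N ⊗ ℂ^N`; the entry `((i,k),(j,l))` is the coefficient of `E_ij ⊗ E_kl`. -/
abbrev Mat2 (N : ℕ) : Type := Matrix (Fin N × Fin N) (Fin N × Fin N) ℂ

/-- The matrix unit `E_ij`. -/
abbrev mE {N : ℕ} (i j : Fin N) : Matrix (Fin N) (Fin N) ℂ := Matrix.single i j 1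

/-- The distribution `δ(x - y + s) K(x, y)`, paired with the test function `f(x) g(y)`. -/
def deltaDist {N : ℕ} (s : ℝ) (K : Circ → Circ → Mat2 N) (f g : C(Circ, ℂ)) : Mat2 N :=
  Matrix.of fun a b => ∫ x : Circ, f x * g (x + (s : Circ)) * K x (x + (s : Circ)) a b

/-- `{A₁(x), B₂(y)} = ∑ E_ij ⊗ E_kl {A_ij(x), B_kl(y)}` equals the distribution `R` in `x, y`
(given by its pairings with test functions `f(x) g(y)`) at the point `P` of the phase space. -/
def HasTensorBracket {N : ℕ} (A B : PhaseSpace N → Circ → Matrix (Fin N) (Fin N) ℂ)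
    (P : PhaseSpace N) (R : C(Circ, ℂ) → C(Circ, ℂ) → Mat2 N) : Prop :=
  ∀ (f g : C(Circ, ℂ)) (i j k l : Fin N),
    HasPoissonBracket (smear f fun P x => A P x i j) (smear g fun P y => B P y k l) P
      (R f g (i, k) (j, l))

/- ### The 1+1 Ruijsenaars-Schneider field theory -/

/-- `q_i(x - ε) - q_j(x) - νε`. -/
def qShift {N : ℕ} (ε : ℝ) (ν : ℂ) (P : PhaseSpace N) (x : Circ) (i j : Fin N) : ℂ :=
  P.2 i (x - (ε : Circ)) - P.2 j x - ν * ε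

/-- The factor of `U_ij(z,x)` depending on `j` and `x` only. -/
def bField {N : ℕ} (τ : ℂ) (ε : ℝ) (ν : ℂ) (P : PhaseSpace N) (x : Circ) (j : Fin N) : ℂ :=
  (∏ a, theta τ (P.2 j x - P.2 a (x - (ε : Circ)) + ν * ε)) /
      (theta τ (ν * ε) * ∏ a ∈ Finset.univ.erase j, theta τ (P.2 j x - P.2 a x)) *
    exp (-ε * P.1 j x)

/-- The `U`-matrix. -/
def Umat {N : ℕ} (τ : ℂ) (ε : ℝ) (ν z : ℂ) (P : PhaseSpace N) (x : Circ) :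
    Matrix (Fin N) (Fin N) ℂ :=
  Matrix.of fun i j => phi τ z (qShift ε ν P x i j) * bField τ ε ν P x j

/-- `U_ij(z,x) (E₁(z + q_i(x-ε) - q_j(x) - νε) - E₁(q_i(x-ε) - q_j(x) - νε))`, written as
`(∂_u φ)(z, q_i(x-ε) - q_j(x) - νε) b_j(x)`: see `dUmat_apply`. -/
def dUmat {N : ℕ} (τ : ℂ) (ε : ℝ) (ν z : ℂ) (P : PhaseSpace N) (x : Circ) :
    Matrix (Fin N) (Fin N) ℂ :=
  Matrix.of fun i j => deriv (phi τ z) (qShift ε ν P x i j) * bField τ ε ν P x j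

theorem dUmat_apply {N : ℕ} {τ : ℂ} (hτ : 0 < τ.im) (ε : ℝ) (ν z : ℂ) (P : PhaseSpace N)
    (x : Circ) (i j : Fin N) (hu : theta τ (qShift ε ν P x i j) ≠ 0)
    (hzu : theta τ (z + qShift ε ν P x i j) ≠ 0) :
    dUmat τ ε ν z P x i j = Umat τ ε ν z P x i j *
      (E1 τ (z + qShift ε ν P x i j) - E1 τ (qShift ε ν P x i j)) := by
  simp only [dUmat, Umat, Matrix.of_apply, deriv_phi hτ hu hzu]
  ring

/-- `U₁ = U ⊗ 1`. -/
def U1 {N : ℕ} (τ : ℂ) (ε : ℝ) (ν z : ℂ) (P : PhaseSpace N) (x : Circ) : Mat2 N :=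
  Umat τ ε ν z P x ⊗ₖ (1 : Matrix (Fin N) (Fin N) ℂ)

/-- `U₂ = 1 ⊗ U`. -/
def U2 {N : ℕ} (τ : ℂ) (ε : ℝ) (ν z : ℂ) (P : PhaseSpace N) (x : Circ) : Mat2 N :=
  (1 : Matrix (Fin N) (Fin N) ℂ) ⊗ₖ Umat τ ε ν z P x

/-- `r₁₂(ζ|x)`, with `ζ = z - w`. -/
def r12 {N : ℕ} (τ ζ : ℂ) (P : PhaseSpace N) (x : Circ) : Mat2 N :=
  (∑ i, ∑ j ∈ Finset.univ.erase i, phi τ ζ (P.2 i x - P.2 j x) • (mE i j ⊗ₖ mE j i))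
    + E1 τ ζ • (∑ i, mE i i ⊗ₖ mE i i)
    - ∑ i, ∑ j ∈ Finset.univ.erase i, E1 τ (P.2 i x - P.2 j x) • (mE i i ⊗ₖ mE j j)

/-- `u₁₂⁺(x)`. -/
def uPlus {N : ℕ} (τ : ℂ) (ε : ℝ) (ν : ℂ) (P : PhaseSpace N) (x : Circ) : Mat2 N :=
  ∑ i, ∑ j, E1 τ (qShift ε ν P x j i) • (mE i i ⊗ₖ mE j j)

/-- `u₁₂⁻(x)`. -/
def uMinus {N : ℕ} (τ : ℂ) (ε : ℝ) (ν : ℂ) (P : PhaseSpace N) (x : Circ) : Mat2 N :=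
  ∑ i, ∑ j, E1 τ (qShift ε ν P x i j) • (mE i i ⊗ₖ mE j j)

/-- The prescribed value of the product `U₁(z,x) s₁₂(z,x)`. -/
def U1s12 {N : ℕ} (τ : ℂ) (ε : ℝ) (ν z : ℂ) (P : PhaseSpace N) (x : Circ) : Mat2 N :=
  ∑ i, ∑ j, dUmat τ ε ν z P x i j • (mE i j ⊗ₖ mE i i)

/-- The prescribed value of the product `U₂(w,x) s₂₁(w,x)`. -/
def U2s21 {N : ℕ} (τ : ℂ) (ε : ℝ) (ν w : ℂ) (P : PhaseSpace N) (x : Circ) : Mat2 N :=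
  ∑ i, ∑ j, dUmat τ ε ν w P x i j • (mE i i ⊗ₖ mE i j)

/-- `s₁₂(z,x)`, the solution of `U₁ s₁₂ = U1s12`; it exists where `U(z,x)` is invertible. -/
def s12 {N : ℕ} (τ : ℂ) (ε : ℝ) (ν z : ℂ) (P : PhaseSpace N) (x : Circ) : Mat2 N :=
  (U1 τ ε ν z P x)⁻¹ * U1s12 τ ε ν z P x

/-- `s₂₁(w,x)`, the solution of `U₂ s₂₁ = U2s21`; it exists where `U(w,x)` is invertible. -/
def s21 {N : ℕ} (τ : ℂ) (ε : ℝ) (ν w : ℂ) (P : PhaseSpace N) (x : Circ) : Mat2 N :=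
  (U2 τ ε ν w P x)⁻¹ * U2s21 τ ε ν w P x

/-- `s₁₂⁺(z,x)`. -/
def sPlus {N : ℕ} (τ : ℂ) (ε : ℝ) (ν z : ℂ) (P : PhaseSpace N) (x : Circ) : Mat2 N :=
  s12 τ ε ν z P x + uPlus τ ε ν P x

/-- `s₁₂⁻(w,x)`. -/
def sMinus {N : ℕ} (τ : ℂ) (ε : ℝ) (ν w : ℂ) (P : PhaseSpace N) (x : Circ) : Mat2 N :=
  s21 τ ε ν w P x + uMinus τ ε ν P x

/-- The product `U₁(z,x) s₁₂⁺(z,x)`, which makes sense also where `U(z,x)` is not invertible. -/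
def U1sPlus {N : ℕ} (τ : ℂ) (ε : ℝ) (ν z : ℂ) (P : PhaseSpace N) (x : Circ) : Mat2 N :=
  U1s12 τ ε ν z P x + U1 τ ε ν z P x * uPlus τ ε ν P x

/-- The product `U₂(w,x) s₁₂⁻(w,x)`, which makes sense also where `U(w,x)` is not invertible. -/
def U2sMinus {N : ℕ} (τ : ℂ) (ε : ℝ) (ν w : ℂ) (P : PhaseSpace N) (x : Circ) : Mat2 N :=
  U2s21 τ ε ν w P x + U2 τ ε ν w P x * uMinus τ ε ν P x

end

/-!
The entry `U_ij(z,x)` is a holomorphic function `uJet` of the finitely many numbers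
`(p(x), q(x), q(x - ε))`, away from the zeros of the denominators. Since the circle is compact, a
field configuration stays away from these zeros under small perturbations, so one may differentiate
under the integral sign (`hasDerivAt_integral_comp`); the smeared field then has functional
derivatives given by the partial derivatives of `uJet`, and the bracket of two smeared fields is a
sum of three integrals, the coefficients of `δ(x - y)`, `δ(x - y + ε)` and `δ(x - y - ε)`
(`hasPoissonBracket_smear`).

The coefficients of the two shifted delta functions are read off from
`∂U_ij/∂p_m = -ε δ_jm U_ij` and the derivative of `U_ij` in `q_m(x - ε)`. The coefficient of
`δ(x - y)` is an identity between functions of `q(x)` and `q(x - ε)`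
(`sum_partialP_mul_partialQ_sub`). The common factors `b_j b_l` drop out of its components, and what
remains are two addition formulas for the Kronecker function: `deriv_phi_mul_phi_sub`, when exactly
one of `i = k` and `j = l` holds for the component at `E_ij ⊗ E_kl`, and `phi_mul_phi_mul_E1`, when
neither does.

Cleared of denominators, these are Weierstrass' three-term identity for `θ` (`theta_three_term'`)
and its confluent form (`theta_three_term_confluent`). No Liouville argument is needed for them:
rearranging the double series gives `θ(x+y) θ(x-y) = f(x) g(y) - g(x) f(y)` with theta series `f`,
`g` of level two (`theta_add_mul_theta_sub`), and the three-term identity is then the Plücker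
relation between two by two determinants.
-/

/-! ### The three-term identity for the theta function -/

/-- The theta series of level two, `∑_{n ∈ ℤ} exp (πiτ(2n+c)²/2 + 2πi(2n+c)x)`; the values `c = 0`
and `c = 1` are the sums over the even and the odd integers. -/
noncomputable def thetaLevelTwo (τ : ℂ) (c : ℤ) (x : ℂ) : ℂ :=
  ∑' n : ℤ, exp (Real.pi * I * τ * (2 * n + c) ^ 2 / 2 + 2 * Real.pi * I * (2 * n + c) * x)

theorem summable_thetaLevelTwo {τ : ℂ} (hτ : 0 < τ.im) (c : ℤ) (x : ℂ) :
    Summable fun n : ℤ =>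
      exp (Real.pi * I * τ * (2 * n + c) ^ 2 / 2 + 2 * Real.pi * I * (2 * n + c) * x) := by
  have h := ((summable_jacobiTheta₂_term_iff (2 * x + c * τ) (2 * τ)).2 (by simpa using hτ)).mul_left
    (exp (Real.pi * I * τ * c ^ 2 / 2 + 2 * Real.pi * I * c * x))
  refine h.congr fun n => ?_
  rw [jacobiTheta₂_term, ← Complex.exp_add]
  congr 1
  ring

theorem summable_theta {τ : ℂ} (hτ : 0 < τ.im) (z : ℂ) :
    Summable fun j : ℤ => exp (2 * Real.pi * I * ((j : ℂ) + 1 / 2) ^ 2 * (τ / 2)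
      + 2 * Real.pi * I * ((j : ℂ) + 1 / 2) * (z + 1 / 2)) := by
  have h := ((summable_jacobiTheta₂_term_iff (z + 1 / 2 + τ / 2) τ).2 hτ).mul_left
    (exp (Real.pi * I * τ / 4 + Real.pi * I * (z + 1 / 2)))
  refine h.congr fun n => ?_
  rw [jacobiTheta₂_term, ← Complex.exp_add]
  congr 1
  ring

/-- Multiplying the two series and summing over `s = m + n` and `t = m - n`, which have opposite
parity, separates the variables. -/
theorem theta_add_mul_theta_sub {τ : ℂ} (hτ : 0 < τ.im) (x y : ℂ) :
    theta τ (x + y) * theta τ (x - y) =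
      thetaLevelTwo τ 0 x * thetaLevelTwo τ 1 y - thetaLevelTwo τ 1 x * thetaLevelTwo τ 0 y := by
  set T : ℂ → ℤ → ℂ := fun z j => exp (2 * Real.pi * I * ((j : ℂ) + 1 / 2) ^ 2 * (τ / 2)
      + 2 * Real.pi * I * ((j : ℂ) + 1 / 2) * (z + 1 / 2)) with hT
  set S : ℤ → ℂ → ℤ → ℂ := fun c x n =>
    exp (Real.pi * I * τ * (2 * n + c) ^ 2 / 2 + 2 * Real.pi * I * (2 * n + c) * x) with hS
  have hTs : ∀ z, Summable fun j => ‖T z j‖ := fun z => (summable_theta hτ z).norm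
  have hSs : ∀ c z, Summable fun j => ‖S c z j‖ := fun c z => (summable_thetaLevelTwo hτ c z).norm
  have hL : HasSum (fun p : ℤ × ℤ => T (x + y) p.1 * T (x - y) p.2)
      (theta τ (x + y) * theta τ (x - y)) := by
    have h := (summable_mul_of_summable_norm (hTs (x + y)) (hTs (x - y))).hasSum
    rw [← tsum_mul_tsum_of_summable_norm (hTs (x + y)) (hTs (x - y))] at h
    rwa [theta, theta, neg_mul_neg]
  have hR : ∀ c d : ℤ, HasSum (fun p : ℤ × ℤ => S c x p.1 * S d y p.2)
      (thetaLevelTwo τ c x * thetaLevelTwo τ d y) := fun c d => by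
    have h := (summable_mul_of_summable_norm (hSs c x) (hSs d y)).hasSum
    rwa [← tsum_mul_tsum_of_summable_norm (hSs c x) (hSs d y)] at h
  -- For the half-integers `m = j + 1/2` and `n = k + 1/2`, the pairs `(j, k)` with `m + n` even and
  -- `m - n` odd are the range of `e₁`, those with `m + n` odd and `m - n` even the range of `e₂`.
  let e₁ : ℤ × ℤ → ℤ × ℤ := fun p => (p.1 + p.2, p.1 - p.2 - 1)
  let e₂ : ℤ × ℤ → ℤ × ℤ := fun p => (p.1 + p.2, p.1 - p.2)
  have he₁ : Function.Injective e₁ := by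
    rintro ⟨a, b⟩ ⟨c, d⟩ h
    simp only [e₁, Prod.mk.injEq] at h ⊢
    omega
  have he₂ : Function.Injective e₂ := by
    rintro ⟨a, b⟩ ⟨c, d⟩ h
    simp only [e₂, Prod.mk.injEq] at h ⊢
    omega
  have hc : IsCompl (Set.range e₁) (Set.range e₂) := by
    constructor
    · rw [Set.disjoint_left]
      rintro _ ⟨⟨a, b⟩, rfl⟩ ⟨⟨c, d⟩, h⟩
      simp only [e₁, e₂, Prod.mk.injEq] at h
      omega
    · rw [codisjoint_iff_le_sup]
      rintro ⟨j, k⟩ -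
      rcases Int.even_or_odd' (j + k) with ⟨m, h | h⟩
      · exact Or.inr ⟨(m, j - m), by simp only [e₂, Prod.mk.injEq]; omega⟩
      · exact Or.inl ⟨(m + 1, j - m - 1), by simp only [e₁, Prod.mk.injEq]; omega⟩
  have h₁ : HasSum ((fun p : ℤ × ℤ => T (x + y) p.1 * T (x - y) p.2) ∘ e₁)
      (thetaLevelTwo τ 0 x * thetaLevelTwo τ 1 y) := by
    refine (hR 0 1).congr_fun fun p => ?_
    simp only [hT, hS, Function.comp, e₁, ← Complex.exp_add]
    refine Complex.exp_eq_exp_iff_exists_int.2 ⟨p.1, ?_⟩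
    push_cast
    ring
  have h₂ : HasSum ((fun p : ℤ × ℤ => T (x + y) p.1 * T (x - y) p.2) ∘ e₂)
      (-(thetaLevelTwo τ 1 x * thetaLevelTwo τ 0 y)) := by
    refine (hR 1 0).neg.congr_fun fun p => ?_
    simp only [hT, hS, Function.comp, e₂, ← Complex.exp_add]
    rw [← Complex.exp_add_pi_mul_I]
    refine Complex.exp_eq_exp_iff_exists_int.2 ⟨p.1, ?_⟩
    push_cast
    ring
  rw [sub_eq_add_neg (thetaLevelTwo τ 0 x * _)]
  refine hL.unique (HasSum.add_isCompl hc ?_ ?_)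
  · exact he₁.hasSum_range_iff.2 h₁
  · exact he₂.hasSum_range_iff.2 h₂

/-- Oddness, read off from the antisymmetry of `θ(x+y)θ(x-y)` at `(z, 0)`. -/
theorem theta_neg {τ : ℂ} (hτ : 0 < τ.im) (z : ℂ) : theta τ (-z) = -theta τ z := by
  have key : ∀ z, theta τ z * (theta τ z + theta τ (-z)) = 0 := fun z => by
    have h₁ := theta_add_mul_theta_sub hτ z 0
    have h₂ := theta_add_mul_theta_sub hτ 0 z
    rw [add_zero, sub_zero] at h₁
    rw [zero_add, zero_sub] at h₂
    linear_combination h₁ + h₂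
  rcases mul_eq_zero.1 (key z) with h | h
  · have h' := key (-z)
    rw [neg_neg, h, add_zero] at h'
    rw [h, mul_self_eq_zero.1 h', neg_zero]
  · linear_combination h

theorem theta_zero {τ : ℂ} (hτ : 0 < τ.im) : theta τ 0 = 0 := by
  have h := theta_neg hτ 0
  rw [neg_zero] at h
  exact self_eq_neg.1 h

theorem deriv_theta_neg {τ : ℂ} (hτ : 0 < τ.im) (z : ℂ) :
    deriv (theta τ) (-z) = deriv (theta τ) z := by
  have h := deriv_comp_neg (theta τ) z
  rw [funext (theta_neg hτ), deriv.fun_neg] at h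
  exact (neg_injective h).symm

theorem E1_neg {τ : ℂ} (hτ : 0 < τ.im) (z : ℂ) : E1 τ (-z) = -E1 τ z := by
  rw [E1, E1, deriv_theta_neg hτ, theta_neg hτ, div_neg]

/-- **Weierstrass' three-term identity**: `theta_add_mul_theta_sub` writes `θ(x+y)θ(x-y)` as a
two by two determinant, and the identity is the Plücker relation between these determinants. -/
theorem theta_three_term {τ : ℂ} (hτ : 0 < τ.im) (a b c d : ℂ) :
    theta τ (a + b) * theta τ (a - b) * (theta τ (c + d) * theta τ (c - d))
      + theta τ (b + c) * theta τ (b - c) * (theta τ (a + d) * theta τ (a - d))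
      + theta τ (c + a) * theta τ (c - a) * (theta τ (b + d) * theta τ (b - d)) = 0 := by
  simp only [theta_add_mul_theta_sub hτ]
  ring

/-- Weierstrass' identity in the variables of the Kronecker functions. -/
theorem theta_three_term' {τ : ℂ} (hτ : 0 < τ.im) (z w A C D : ℂ) :
    theta τ (z + A) * theta τ (w + (C + D - A)) * theta τ (D - C) * theta τ (z - w) =
      theta τ (A - C) * theta τ (z + D) * theta τ (w + C) * theta τ (z - w + A - D)
        - theta τ (A - D) * theta τ (z + C) * theta τ (w + D) * theta τ (z - w + A - C) := by
  -- solves `a + b = z + A`, `a - b = w + (C + D - A)`, `c + d = D - C`, `c - d = z - w`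
  have h := theta_three_term hτ ((z + w + C + D) / 2) ((z - w + 2 * A - C - D) / 2)
    ((D - C + z - w) / 2) ((D - C - z + w) / 2)
  rw [show (z + w + C + D) / 2 + (z - w + 2 * A - C - D) / 2 = z + A by ring,
    show (z + w + C + D) / 2 - (z - w + 2 * A - C - D) / 2 = w + (C + D - A) by ring,
    show (D - C + z - w) / 2 + (D - C - z + w) / 2 = D - C by ring,
    show (D - C + z - w) / 2 - (D - C - z + w) / 2 = z - w by ring,
    show (z - w + 2 * A - C - D) / 2 + (D - C + z - w) / 2 = z - w + A - C by ring,
    show (z - w + 2 * A - C - D) / 2 - (D - C + z - w) / 2 = A - D by ring,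
    show (z + w + C + D) / 2 + (D - C - z + w) / 2 = w + D by ring,
    show (z + w + C + D) / 2 - (D - C - z + w) / 2 = z + C by ring,
    show (D - C + z - w) / 2 + (z + w + C + D) / 2 = z + D by ring,
    show (D - C + z - w) / 2 - (z + w + C + D) / 2 = -(w + C) by ring,
    show (z - w + 2 * A - C - D) / 2 + (D - C - z + w) / 2 = A - C by ring,
    show (z - w + 2 * A - C - D) / 2 - (D - C - z + w) / 2 = z - w + A - D by ring,
    theta_neg hτ] at h
  linear_combination h

/-- The confluent form of Weierstrass' identity, its derivative in `z` at `z = w`. Where no theta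
vanishes it is the addition formula for `E₁(a) + E₁(b) + E₁(c) - E₁(a + b + c)`. -/
theorem theta_three_term_confluent {τ : ℂ} (hτ : 0 < τ.im) (a b c : ℂ) :
    deriv (theta τ) a * theta τ b * theta τ c * theta τ (a + b + c)
      + theta τ a * deriv (theta τ) b * theta τ c * theta τ (a + b + c)
      + theta τ a * theta τ b * deriv (theta τ) c * theta τ (a + b + c)
      - theta τ a * theta τ b * theta τ c * deriv (theta τ) (a + b + c) =
      deriv (theta τ) 0 * theta τ (a + b) * theta τ (a + c) * theta τ (b + c) := by
  have hd : ∀ v t : ℂ, HasDerivAt (fun z => theta τ (z + v)) (deriv (theta τ) (t + v)) t :=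
    fun v t => HasDerivAt.comp_add_const t v (differentiable_theta hτ (t + v)).hasDerivAt
  -- the three-term identity as an identity between functions of `z`, to be differentiated at `0`;
  -- the factor `θ(z + 0)`, which vanishes there, leaves `θ'(0)` on the left
  have h : (fun z => theta τ (z + (a + b)) * theta τ (a + c) * theta τ (-(b + c)) * theta τ (z + 0)) =
      fun z => theta τ (-c) * theta τ (z + a) * theta τ (a + b + c) * theta τ (z + b)
        - theta τ b * theta τ (z + (a + b + c)) * theta τ a * theta τ (z + -c) := by
    funext z
    have h := theta_three_term' hτ z 0 (a + b) (a + b + c) a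
    ring_nf at h ⊢
    exact h
  have hl := (((hd (a + b) 0).mul_const (theta τ (a + c))).mul_const (theta τ (-(b + c)))).mul
    (hd 0 0)
  have hr := ((((hd a 0).const_mul (theta τ (-c))).mul_const (theta τ (a + b + c))).mul
    (hd b 0)).sub ((((hd (a + b + c) 0).const_mul (theta τ b)).mul_const (theta τ a)).mul
    (hd (-c) 0))
  have e := hl.unique (hr.congr_of_eventuallyEq (Filter.Eventually.of_forall fun z => congrFun h z))
  simp only [zero_add, theta_neg hτ, deriv_theta_neg hτ, theta_zero hτ] at e
  linear_combination e

/-! ### Addition formulas for the Kronecker function -/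

/-- `∂_u φ(z,u)` in a form that needs no assumption on `z + u`, unlike `deriv_phi`. -/
theorem hasDerivAt_phi {τ : ℂ} (hτ : 0 < τ.im) (z : ℂ) {u : ℂ} (hu : theta τ u ≠ 0) :
    HasDerivAt (phi τ z) (deriv (theta τ) 0 *
      (deriv (theta τ) (z + u) * theta τ u - theta τ (z + u) * deriv (theta τ) u) /
        (theta τ z * theta τ u ^ 2)) u := by
  have hd := differentiable_theta hτ
  have h₁ : HasDerivAt (fun v => theta τ (z + v)) (deriv (theta τ) (z + u)) u :=
    HasDerivAt.comp_const_add z u (hd (z + u)).hasDerivAt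
  have h₂ := ((h₁.div (hd u).hasDerivAt hu).const_mul (deriv (theta τ) 0 / theta τ z))
  refine (h₂.congr_deriv ?_).congr_of_eventuallyEq (Filter.Eventually.of_forall fun v => ?_)
  · ring
  · simp only [phi, Pi.div_apply]
    ring

/-- The relation behind the components of the bracket in which two row indices or two column
indices coincide. It holds also where `z + u` or `w + v` is a zero of `θ`. -/
theorem deriv_phi_mul_phi_sub {τ : ℂ} (hτ : 0 < τ.im) {z w u v : ℂ} (hz : theta τ z ≠ 0)
    (hw : theta τ w ≠ 0) (hzw : theta τ (z - w) ≠ 0) (hu : theta τ u ≠ 0) (hv : theta τ v ≠ 0)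
    (huv : theta τ (u - v) ≠ 0) :
    deriv (phi τ z) u * phi τ w v - phi τ z u * deriv (phi τ w) v =
      phi τ z u * phi τ w v * (E1 τ (z - w) + E1 τ (u - v) + E1 τ v - E1 τ u)
        - phi τ (z - w) (u - v) * phi τ z v * phi τ w u := by
  have h := theta_three_term_confluent hτ (z - w) (u - v) (w + v)
  rw [show z - w + (u - v) + (w + v) = z + u by ring, show z - w + (w + v) = z + v by ring,
    show u - v + (w + v) = w + u by ring] at h
  rw [(hasDerivAt_phi hτ z hu).deriv, (hasDerivAt_phi hτ w hv).deriv]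
  simp only [phi, E1]
  field_simp
  linear_combination (-deriv (theta τ) 0 ^ 2 * theta τ u * theta τ v) * h

/-- The relation behind the components of the bracket with distinct row and distinct column
indices. -/
theorem phi_mul_phi_mul_E1 {τ : ℂ} (hτ : 0 < τ.im) {z w A B C D : ℂ} (hz : theta τ z ≠ 0)
    (hw : theta τ w ≠ 0) (hzw : theta τ (z - w) ≠ 0) (hAB : A + B = C + D)
    (hA : theta τ A ≠ 0) (hB : theta τ B ≠ 0) (hC : theta τ C ≠ 0) (hD : theta τ D ≠ 0)
    (hAC : theta τ (A - C) ≠ 0) (hAD : theta τ (A - D) ≠ 0) :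
    phi τ z A * phi τ w B * (E1 τ (A - C) - E1 τ (A - D) - E1 τ D + E1 τ C) =
      phi τ z C * phi τ w D * phi τ (z - w) (A - C)
        - phi τ (z - w) (A - D) * phi τ z D * phi τ w C := by
  obtain rfl : B = C + D - A := by linear_combination hAB
  have h₁ := theta_three_term_confluent hτ (A - C) C (D - A)
  rw [show A - C + C = A by ring, show A + (D - A) = D by ring,
    show A - C + (D - A) = D - C by ring, show C + (D - A) = C + D - A by ring,
    ← neg_sub A D, theta_neg hτ, deriv_theta_neg hτ] at h₁
  have h₂ := theta_three_term' hτ z w A C D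
  -- by the confluent identity for `A - C`, `C`, `D - A`, whose sum is `D`
  have h₃ : E1 τ (A - C) - E1 τ (A - D) - E1 τ D + E1 τ C =
      -(deriv (theta τ) 0 * theta τ A * theta τ (D - C) * theta τ (C + D - A)) /
        (theta τ (A - C) * theta τ C * theta τ (A - D) * theta τ D) := by
    simp only [E1]
    field_simp
    linear_combination -h₁
  rw [h₃]
  simp only [phi, ← add_sub_assoc, ← add_assoc] at h₂ ⊢
  field_simp
  linear_combination (-deriv (theta τ) 0 ^ 3) * h₂

/-! ### Functional derivatives and brackets of local fields -/

theorem integrable_circ {g : Circ → ℂ} (hg : Continuous g) : Integrable g :=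
  hg.integrable_of_hasCompactSupport (HasCompactSupport.of_compactSpace _)

/-- Differentiation under the integral sign, for a composite with a function that is continuously
differentiable on a neighbourhood of the compact image of the circle. -/
theorem hasDerivAt_integral_comp {E : Type*} [NormedAddCommGroup E] [NormedSpace ℂ E]
    {u : E → ℂ} {Ω : Set E} (hΩ : IsOpen Ω) (hu : ContDiffOn ℂ 1 u Ω) {c k : Circ → E}
    (hc : Continuous c) (hk : Continuous k) (hcΩ : ∀ x, c x ∈ Ω) (f : C(Circ, ℂ)) :
    HasDerivAt (fun t : ℂ => ∫ x : Circ, f x * u (c x + t • k x))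
      (∫ x : Circ, f x * fderiv ℂ u (c x) (k x)) 0 := by
  let L : ℂ × Circ → E := fun s => c s.2 + s.1 • k s.2
  have hL : Continuous L := by fun_prop
  -- the path stays in `Ω` for all `x` and all `t` in some closed disc
  obtain ⟨V, W, hV, hW, h0, hWuniv, hVW⟩ := generalized_tube_lemma (s := {(0 : ℂ)})
    isCompact_singleton (t := (Set.univ : Set Circ)) isCompact_univ (hΩ.preimage hL)
    (by
      rintro ⟨t, x⟩ ⟨rfl : t = 0, -⟩
      simp [L, hcΩ])
  obtain ⟨r, hr, hrV⟩ := Metric.nhds_basis_closedBall.mem_iff.1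
    (hV.mem_nhds (h0 (Set.mem_singleton _)))
  have hmem : ∀ t ∈ Metric.closedBall (0 : ℂ) r, ∀ x, c x + t • k x ∈ Ω := fun t ht x =>
    hVW (Set.mk_mem_prod (hrV ht) (hWuniv (Set.mem_univ x)))
  have hdu : ContinuousOn (fun s : ℂ × Circ => f s.2 * fderiv ℂ u (L s) (k s.2))
      (Metric.closedBall 0 r ×ˢ Set.univ) := by
    have h₁ : ContinuousOn (fun s : ℂ × Circ => fderiv ℂ u (L s))
        (Metric.closedBall 0 r ×ˢ Set.univ) :=
      (hu.continuousOn_fderiv_of_isOpen hΩ le_rfl).comp hL.continuousOn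
        fun s hs => hmem s.1 hs.1 s.2
    have h₂ : Continuous fun s : ℂ × Circ => k s.2 := by fun_prop
    have h₃ : Continuous fun s : ℂ × Circ => f s.2 := by fun_prop
    exact h₃.continuousOn.mul (h₁.clm_apply h₂.continuousOn)
  obtain ⟨C, hC⟩ := ((isCompact_closedBall (0 : ℂ) r).prod isCompact_univ).exists_bound_of_continuousOn
    hdu
  have hcont : ∀ t ∈ Metric.closedBall (0 : ℂ) r, Continuous fun x => f x * u (c x + t • k x) :=
    fun t ht => f.continuous.mul
      (hu.continuousOn.comp_continuous (by fun_prop) fun x => hmem t ht x)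
  have h0r : (0 : ℂ) ∈ Metric.closedBall (0 : ℂ) r := Metric.mem_closedBall_self hr.le
  have h := hasDerivAt_integral_of_dominated_loc_of_deriv_le (μ := (volume : Measure Circ))
    (F := fun t x => f x * u (c x + t • k x))
    (F' := fun t x => f x * fderiv ℂ u (c x + t • k x) (k x)) (x₀ := (0 : ℂ))
    (bound := fun _ => C) (Metric.closedBall_mem_nhds 0 hr)
    (by
      filter_upwards [Metric.closedBall_mem_nhds (0 : ℂ) hr] with t ht
      exact (hcont t ht).aestronglyMeasurable)
    (integrable_circ (hcont 0 h0r))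
    (by
      have : Continuous fun x => f x * fderiv ℂ u (c x + (0 : ℂ) • k x) (k x) :=
        hdu.comp_continuous (f := fun x : Circ => ((0 : ℂ), x)) (by fun_prop)
          fun x => ⟨h0r, Set.mem_univ x⟩
      exact this.aestronglyMeasurable)
    (Filter.Eventually.of_forall fun x t ht => hC (t, x) ⟨ht, Set.mem_univ x⟩)
    (integrable_const C)
    (Filter.Eventually.of_forall fun x t ht => by
      have h₁ : HasFDerivAt u (fderiv ℂ u (c x + t • k x)) (c x + t • k x) :=
        ((hu.differentiableOn one_ne_zero).differentiableAt
          (hΩ.mem_nhds (hmem t ht x))).hasFDerivAt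
      have h₂ : HasDerivAt (fun t : ℂ => c x + t • k x) (k x) t := by
        simpa using ((hasDerivAt_id t).smul_const (k x)).const_add (c x)
      exact (h₁.comp_hasDerivAt t h₂).const_mul (f x))
  simpa using h.2

/-- The space of values of `(p(x), q(x), q(x - ε))`. -/
abbrev ShiftJet (N : ℕ) : Type := (Fin N → ℂ) × (Fin N → ℂ) × (Fin N → ℂ)

/-- The values `(p(x), q(x), q(x - ε))` of the fields on which the local fields of the model
depend. -/
noncomputable def shiftJet {N : ℕ} (ε : ℝ) (P : PhaseSpace N) (x : Circ) : ShiftJet N :=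
  (fun i => P.1 i x, fun i => P.2 i x, fun i => P.2 i (x - (ε : Circ)))

/-- `∂u/∂p_m`. -/
noncomputable def partialP {N : ℕ} (u : ShiftJet N → ℂ) (m : Fin N) (c : ShiftJet N) : ℂ :=
  fderiv ℂ u c (Pi.single m 1, 0, 0)

/-- `∂u/∂q_m(x)`. -/
noncomputable def partialQ {N : ℕ} (u : ShiftJet N → ℂ) (m : Fin N) (c : ShiftJet N) : ℂ :=
  fderiv ℂ u c (0, Pi.single m 1, 0)

/-- `∂u/∂q_m(x - ε)`. -/
noncomputable def partialQShift {N : ℕ} (u : ShiftJet N → ℂ) (m : Fin N) (c : ShiftJet N) : ℂ :=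
  fderiv ℂ u c (0, 0, Pi.single m 1)

theorem continuous_shiftJet {N : ℕ} (ε : ℝ) (P : PhaseSpace N) : Continuous (shiftJet ε P) := by
  unfold shiftJet
  fun_prop

theorem fderiv_shiftJet {N : ℕ} (u : ShiftJet N → ℂ) (c k : ShiftJet N) :
    fderiv ℂ u c k = ∑ m, (partialP u m c * k.1 m + partialQ u m c * k.2.1 m
      + partialQShift u m c * k.2.2 m) := by
  have hk : k = ∑ m, (k.1 m • ((Pi.single m 1, 0, 0) : ShiftJet N)
      + k.2.1 m • ((0, Pi.single m 1, 0) : ShiftJet N)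
      + k.2.2 m • ((0, 0, Pi.single m 1) : ShiftJet N)) := by
    refine Prod.ext ?_ (Prod.ext ?_ ?_) <;> funext i <;>
      simp [Prod.fst_sum, Prod.snd_sum, Finset.sum_apply, Pi.single_apply]
  conv_lhs => rw [hk]
  rw [map_sum]
  refine Finset.sum_congr rfl fun m _ => ?_
  simp only [map_add, map_smul, smul_eq_mul, partialP, partialQ, partialQShift]
  ring

section LocalFields

variable {N : ℕ} {ε : ℝ} {P : PhaseSpace N} {u v : ShiftJet N → ℂ} {Ω : Set (ShiftJet N)}

theorem continuous_partialP (hΩ : IsOpen Ω) (hu : ContDiffOn ℂ 1 u Ω)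
    (hP : ∀ x, shiftJet ε P x ∈ Ω) (m : Fin N) :
    Continuous fun x => partialP u m (shiftJet ε P x) :=
  ((hu.continuousOn_fderiv_of_isOpen hΩ le_rfl).comp_continuous
    (continuous_shiftJet ε P) hP).clm_apply continuous_const

theorem continuous_partialQ (hΩ : IsOpen Ω) (hu : ContDiffOn ℂ 1 u Ω)
    (hP : ∀ x, shiftJet ε P x ∈ Ω) (m : Fin N) :
    Continuous fun x => partialQ u m (shiftJet ε P x) :=
  ((hu.continuousOn_fderiv_of_isOpen hΩ le_rfl).comp_continuous
    (continuous_shiftJet ε P) hP).clm_apply continuous_const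

theorem continuous_partialQShift (hΩ : IsOpen Ω) (hu : ContDiffOn ℂ 1 u Ω)
    (hP : ∀ x, shiftJet ε P x ∈ Ω) (m : Fin N) :
    Continuous fun x => partialQShift u m (shiftJet ε P x) :=
  ((hu.continuousOn_fderiv_of_isOpen hΩ le_rfl).comp_continuous
    (continuous_shiftJet ε P) hP).clm_apply continuous_const

/-- The functional derivatives of a smeared local field. The value at `x` of the position field
enters the local field at `x` and, through the shifted argument, the local field at `x + ε`. -/
theorem hasFunctionalDeriv_smear (hΩ : IsOpen Ω) (hu : ContDiffOn ℂ 1 u Ω)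
    (hP : ∀ x, shiftJet ε P x ∈ Ω) (f : C(Circ, ℂ)) (Dp Dq : Fin N → C(Circ, ℂ))
    (hDp : ∀ m x, Dp m x = f x * partialP u m (shiftJet ε P x))
    (hDq : ∀ m x, Dq m x = f x * partialQ u m (shiftJet ε P x)
      + f (x + (ε : Circ)) * partialQShift u m (shiftJet ε P (x + (ε : Circ)))) :
    HasFunctionalDeriv (smear f fun P x => u (shiftJet ε P x)) P Dp Dq := by
  intro h
  have key := hasDerivAt_integral_comp hΩ hu (continuous_shiftJet ε P) (continuous_shiftJet ε h)
    hP f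
  refine key.congr_deriv ?_
  have cP := continuous_partialP hΩ hu hP
  have cQ := continuous_partialQ hΩ hu hP
  have cS := continuous_partialQShift hΩ hu hP
  simp only [fderiv_shiftJet, Finset.mul_sum]
  rw [integral_finsetSum _ fun m _ => integrable_circ (by
    have := cP m; have := cQ m; have := cS m; have := continuous_shiftJet ε h; fun_prop)]
  refine Finset.sum_congr rfl fun m _ => ?_
  have c₁ : Continuous fun x => f x * partialP u m (shiftJet ε P x) * h.1 m x
      + f x * partialQ u m (shiftJet ε P x) * h.2 m x := by
    have := cP m; have := cQ m; fun_prop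
  have c₂ : Continuous fun x =>
      f x * partialQShift u m (shiftJet ε P x) * h.2 m (x - (ε : Circ)) := by
    have := cS m; fun_prop
  have c₃ : Continuous fun x => f (x + (ε : Circ)) *
      partialQShift u m (shiftJet ε P (x + (ε : Circ))) * h.2 m x := by
    have := (cS m).comp (continuous_add_const (ε : Circ))
    simp only [Function.comp_def] at this
    fun_prop
  have e := integral_add_right_eq_self (μ := (volume : Measure Circ)) (fun x =>
    f x * partialQShift u m (shiftJet ε P x) * h.2 m (x - (ε : Circ))) (ε : Circ)
  simp only [add_sub_cancel_right] at e
  calc _ = ∫ x : Circ, ((f x * partialP u m (shiftJet ε P x) * h.1 m x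
      + f x * partialQ u m (shiftJet ε P x) * h.2 m x)
      + f x * partialQShift u m (shiftJet ε P x) * h.2 m (x - (ε : Circ))) := by
        refine integral_congr_ae (Filter.Eventually.of_forall fun x => ?_)
        simp only [shiftJet]
        ring
    _ = _ := by
        rw [integral_add (integrable_circ c₁) (integrable_circ c₂), ← e,
          ← integral_add (integrable_circ c₁) (integrable_circ c₃)]
        refine integral_congr_ae (Filter.Eventually.of_forall fun x => ?_)
        simp only [hDp, hDq]
        ring

/-- The bracket of two smeared local fields. Its three terms are the coefficients of `δ(x - y)`,
`δ(x - y + ε)` and `δ(x - y - ε)`. -/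
theorem hasPoissonBracket_smear (hΩ : IsOpen Ω) (hu : ContDiffOn ℂ 1 u Ω) (hv : ContDiffOn ℂ 1 v Ω)
    (hP : ∀ x, shiftJet ε P x ∈ Ω) (f g : C(Circ, ℂ)) :
    HasPoissonBracket (smear f fun P x => u (shiftJet ε P x))
      (smear g fun P x => v (shiftJet ε P x)) P
      ((∫ x : Circ, f x * g x * ∑ m,
          (partialP u m (shiftJet ε P x) * partialQ v m (shiftJet ε P x)
            - partialQ u m (shiftJet ε P x) * partialP v m (shiftJet ε P x)))
        + (∫ x : Circ, f x * g (x + (ε : Circ)) * ∑ m,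
          partialP u m (shiftJet ε P x) * partialQShift v m (shiftJet ε P (x + (ε : Circ))))
        - ∫ x : Circ, f x * g (x - (ε : Circ)) * ∑ m,
          partialQShift u m (shiftJet ε P x) * partialP v m (shiftJet ε P (x - (ε : Circ)))) := by
  have cP := fun {w} (hw : ContDiffOn ℂ 1 w Ω) => continuous_partialP hΩ hw hP
  have cQ := fun {w} (hw : ContDiffOn ℂ 1 w Ω) => continuous_partialQ hΩ hw hP
  have cS := fun {w} (hw : ContDiffOn ℂ 1 w Ω) => continuous_partialQShift hΩ hw hP
  have cS' : ∀ {w}, ContDiffOn ℂ 1 w Ω → ∀ m, Continuous fun x =>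
      partialQShift w m (shiftJet ε P (x + (ε : Circ))) := fun hw m =>
    (cS hw m).comp (continuous_add_const (ε : Circ))
  have cP' : ∀ {w}, ContDiffOn ℂ 1 w Ω → ∀ m, Continuous fun x =>
      partialP w m (shiftJet ε P (x - (ε : Circ))) := fun hw m =>
    (cP hw m).comp (continuous_sub_right (ε : Circ))
  have hcp : ∀ {w} (hw : ContDiffOn ℂ 1 w Ω) (f : C(Circ, ℂ)) (m : Fin N), Continuous fun x =>
      f x * partialP w m (shiftJet ε P x) := fun hw f m => by
    have := cP hw m; fun_prop
  have hcq : ∀ {w} (hw : ContDiffOn ℂ 1 w Ω) (f : C(Circ, ℂ)) (m : Fin N), Continuous fun x =>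
      f x * partialQ w m (shiftJet ε P x)
      + f (x + (ε : Circ)) * partialQShift w m (shiftJet ε P (x + (ε : Circ))) := fun hw f m => by
    have := cQ hw m; have := cS' hw m; fun_prop
  refine ⟨fun m => ⟨_, hcp hu f m⟩, fun m => ⟨_, hcq hu f m⟩, fun m => ⟨_, hcp hv g m⟩,
    fun m => ⟨_, hcq hv g m⟩, hasFunctionalDeriv_smear hΩ hu hP f _ _ (fun _ _ => rfl)
    fun _ _ => rfl, hasFunctionalDeriv_smear hΩ hv hP g _ _ (fun _ _ => rfl) fun _ _ => rfl, ?_⟩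
  have e := integral_add_right_eq_self (μ := (volume : Measure Circ)) (fun x =>
    f x * g (x - (ε : Circ)) * ∑ m, partialQShift u m (shiftJet ε P x) *
      partialP v m (shiftJet ε P (x - (ε : Circ)))) (ε : Circ)
  simp only [add_sub_cancel_right] at e
  rw [← e, ← integral_add, ← integral_sub, ← integral_finsetSum]
  · refine integral_congr_ae (Filter.Eventually.of_forall fun x => ?_)
    simp only [ContinuousMap.coe_mk, Finset.mul_sum, ← Finset.sum_add_distrib,
      ← Finset.sum_sub_distrib]
    refine Finset.sum_congr rfl fun m _ => ?_
    ring
  · intro m _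
    have := hcp hu f m; have := hcp hv g m; have := hcq hu f m; have := hcq hv g m
    exact integrable_circ (by simp only [ContinuousMap.coe_mk]; fun_prop)
  · have := cP hu; have := cP hv; have := cQ hu; have := cQ hv; have := cS' hv
    exact integrable_circ (by fun_prop)
  · have := cP hv; have := cS' hu
    exact integrable_circ (by fun_prop)
  · have := cP hu; have := cP hv; have := cQ hu; have := cQ hv
    exact integrable_circ (by fun_prop)
  · have := cP hu; have := cS' hv
    exact integrable_circ (by fun_prop)

end LocalFields

/-! ### The entries of `U` as functions of the local field values -/

section LocalU

variable {N : ℕ} {τ : ℂ} {ε : ℝ} {ν : ℂ}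

/-- `bField` as a function of the values `(p(x), q(x), q(x - ε))`. -/
noncomputable def bJet (τ : ℂ) (ε : ℝ) (ν : ℂ) (j : Fin N) (c : ShiftJet N) : ℂ :=
  (∏ a, theta τ (c.2.1 j - c.2.2 a + ν * ε)) /
      (theta τ (ν * ε) * ∏ a ∈ Finset.univ.erase j, theta τ (c.2.1 j - c.2.1 a)) *
    exp (-ε * c.1 j)

/-- The entry `U_ij(z,x)` as a function of the values `(p(x), q(x), q(x - ε))`. -/
noncomputable def uJet (τ : ℂ) (ε : ℝ) (ν z : ℂ) (i j : Fin N) (c : ShiftJet N) : ℂ :=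
  phi τ z (c.2.2 i - c.2.1 j - ν * ε) * bJet τ ε ν j c

/-- The values `(p(x), q(x), q(x - ε))` away from the poles of the entries of `U`. -/
def regularJets (N : ℕ) (τ : ℂ) (ε : ℝ) (ν : ℂ) : Set (ShiftJet N) :=
  {c | (∀ i j, theta τ (c.2.2 i - c.2.1 j - ν * ε) ≠ 0) ∧
    ∀ i j, i ≠ j → theta τ (c.2.1 i - c.2.1 j) ≠ 0}

theorem Umat_eq_uJet (z : ℂ) (P : PhaseSpace N) (x : Circ) (i j : Fin N) :
    Umat τ ε ν z P x i j = uJet τ ε ν z i j (shiftJet ε P x) := rfl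

theorem isOpen_regularJets (hτ : 0 < τ.im) : IsOpen (regularJets N τ ε ν) := by
  have hc := (differentiable_theta hτ).continuous
  simp only [regularJets, Set.ofPred_and, Set.ofPred_forall]
  refine IsOpen.inter ?_ ?_
  · refine isOpen_iInter_of_finite fun i => isOpen_iInter_of_finite fun j => ?_
    exact isOpen_ne_fun (by fun_prop) (by fun_prop)
  · refine isOpen_iInter_of_finite fun i => isOpen_iInter_of_finite fun j =>
      isOpen_iInter_of_finite fun _ => ?_
    exact isOpen_ne_fun (by fun_prop) (by fun_prop)

theorem contDiffOn_bJet (hτ : 0 < τ.im) (hνε : theta τ (ν * ε) ≠ 0) (j : Fin N) :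
    ContDiffOn ℂ 1 (bJet τ ε ν j) (regularJets N τ ε ν) := by
  have hθ : ContDiff ℂ 1 (theta τ) := (differentiable_theta hτ).contDiff
  unfold bJet
  refine ContDiffOn.mul (ContDiffOn.div ?_ ?_ ?_) ?_
  · exact (contDiff_prod fun a _ => hθ.comp (by fun_prop)).contDiffOn
  · exact (contDiff_const.mul (contDiff_prod fun a _ => hθ.comp (by fun_prop))).contDiffOn
  · intro c hc
    refine mul_ne_zero hνε (Finset.prod_ne_zero_iff.2 fun a ha => ?_)
    exact hc.2 j a (Finset.ne_of_mem_erase ha).symm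
  · exact ContDiff.contDiffOn (by fun_prop)

theorem contDiffOn_uJet (hτ : 0 < τ.im) (hνε : theta τ (ν * ε) ≠ 0) {z : ℂ} (hz : theta τ z ≠ 0)
    (i j : Fin N) : ContDiffOn ℂ 1 (uJet τ ε ν z i j) (regularJets N τ ε ν) := by
  have hθ : ContDiff ℂ 1 (theta τ) := (differentiable_theta hτ).contDiff
  refine ContDiffOn.mul ?_ (contDiffOn_bJet hτ hνε j)
  simp only [phi]
  refine ContDiffOn.div ?_ ?_ ?_
  · exact (contDiff_const.mul (hθ.comp (by fun_prop))).contDiffOn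
  · exact (contDiff_const.mul (hθ.comp (by fun_prop))).contDiffOn
  · exact fun c hc => mul_ne_zero hz (hc.1 i j)

theorem differentiableAt_bJet (hτ : 0 < τ.im) (hνε : theta τ (ν * ε) ≠ 0) (j : Fin N)
    {c : ShiftJet N} (hc : c ∈ regularJets N τ ε ν) : DifferentiableAt ℂ (bJet τ ε ν j) c :=
  ((contDiffOn_bJet hτ hνε j).differentiableOn one_ne_zero).differentiableAt
    ((isOpen_regularJets hτ).mem_nhds hc)

theorem fderiv_eq_of_hasDerivAt_line {E : Type*} [NormedAddCommGroup E] [NormedSpace ℂ E]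
    {u : E → ℂ} {c k : E} {d : ℂ} (hu : DifferentiableAt ℂ u c)
    (h : HasDerivAt (fun t : ℂ => u (c + t • k)) d 0) : fderiv ℂ u c k = d :=
  (hu.hasFDerivAt.hasLineDerivAt k).unique h

theorem fderiv_uJet (hτ : 0 < τ.im) (hνε : theta τ (ν * ε) ≠ 0) {z : ℂ} (hz : theta τ z ≠ 0)
    (i j : Fin N) {c : ShiftJet N} (hc : c ∈ regularJets N τ ε ν) (k : ShiftJet N) :
    fderiv ℂ (uJet τ ε ν z i j) c k =
      deriv (phi τ z) (c.2.2 i - c.2.1 j - ν * ε) * bJet τ ε ν j c * (k.2.2 i - k.2.1 j)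
        + phi τ z (c.2.2 i - c.2.1 j - ν * ε) * fderiv ℂ (bJet τ ε ν j) c k := by
  have hd : DifferentiableAt ℂ (uJet τ ε ν z i j) c :=
    ((contDiffOn_uJet hτ hνε hz i j).differentiableOn one_ne_zero).differentiableAt
      ((isOpen_regularJets hτ).mem_nhds hc)
  refine fderiv_eq_of_hasDerivAt_line hd ?_
  have hb := (differentiableAt_bJet hτ hνε j hc).hasFDerivAt.hasLineDerivAt k
  have hl : HasDerivAt (fun t : ℂ => c.2.2 i - c.2.1 j - ν * ε + t * (k.2.2 i - k.2.1 j))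
      (1 * (k.2.2 i - k.2.1 j)) 0 := ((hasDerivAt_id' (0 : ℂ)).mul_const _).const_add _
  have hφ : HasDerivAt (phi τ z) (deriv (phi τ z) (c.2.2 i - c.2.1 j - ν * ε))
      (c.2.2 i - c.2.1 j - ν * ε + 0 * (k.2.2 i - k.2.1 j)) := by
    rw [zero_mul, add_zero]
    exact (hasDerivAt_phi hτ z (hc.1 i j)).differentiableAt.hasDerivAt
  refine (((hφ.comp (0 : ℂ) hl).mul hb).congr_deriv ?_).congr_of_eventuallyEq
    (Filter.Eventually.of_forall fun t => ?_)
  · simp only [Function.comp, zero_mul, add_zero, zero_smul]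
    ring
  · simp only [uJet, Pi.mul_apply, Function.comp]
    congr 2
    simp
    ring

theorem partialP_bJet (hτ : 0 < τ.im) (hνε : theta τ (ν * ε) ≠ 0) (m j : Fin N) {c : ShiftJet N}
    (hc : c ∈ regularJets N τ ε ν) :
    partialP (bJet τ ε ν j) m c = if m = j then -ε * bJet τ ε ν j c else 0 := by
  refine fderiv_eq_of_hasDerivAt_line (differentiableAt_bJet hτ hνε j hc) ?_
  have h : HasDerivAt (fun t : ℂ => c.1 j + t * (Pi.single m (1 : ℂ) : Fin N → ℂ) j)
      (1 * (Pi.single m (1 : ℂ) : Fin N → ℂ) j) 0 :=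
    ((hasDerivAt_id' (0 : ℂ)).mul_const _).const_add _
  refine (((h.const_mul (-(ε : ℂ))).cexp.const_mul
    ((∏ a, theta τ (c.2.1 j - c.2.2 a + ν * ε)) / (theta τ (ν * ε) *
      ∏ a ∈ Finset.univ.erase j, theta τ (c.2.1 j - c.2.1 a)))).congr_deriv ?_).congr_of_eventuallyEq
    (Filter.Eventually.of_forall fun t => ?_)
  · rcases eq_or_ne m j with rfl | hm
    · simp only [bJet, Pi.single_eq_same, if_true, mul_one, add_zero]
      ring
    · simp [hm, hm.symm]
  · simp [bJet]

theorem partialQ_bJet_of_ne (hτ : 0 < τ.im) (hνε : theta τ (ν * ε) ≠ 0) {m j : Fin N}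
    (hm : m ≠ j) {c : ShiftJet N} (hc : c ∈ regularJets N τ ε ν) :
    partialQ (bJet τ ε ν j) m c = bJet τ ε ν j c * E1 τ (c.2.1 j - c.2.1 m) := by
  refine fderiv_eq_of_hasDerivAt_line (differentiableAt_bJet hτ hνε j hc) ?_
  have hmem : m ∈ Finset.univ.erase j := Finset.mem_erase.2 ⟨hm, Finset.mem_univ m⟩
  have hθ := hc.2 j m hm.symm
  -- along this line only the factor `a = m` of the denominator moves
  have hline : ∀ t : ℂ, bJet τ ε ν j (c + t • ((0, Pi.single m 1, 0) : ShiftJet N)) =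
      (∏ a, theta τ (c.2.1 j - c.2.2 a + ν * ε)) / (theta τ (ν * ε) *
        ∏ a ∈ (Finset.univ.erase j).erase m, theta τ (c.2.1 j - c.2.1 a)) * exp (-ε * c.1 j)
        / theta τ (c.2.1 j - c.2.1 m - t) := fun t => by
    rw [bJet, ← Finset.mul_prod_erase _ _ hmem]
    have h₁ : ∏ a ∈ (Finset.univ.erase j).erase m, theta τ
        ((c + t • ((0, Pi.single m 1, 0) : ShiftJet N)).2.1 j
          - (c + t • ((0, Pi.single m 1, 0) : ShiftJet N)).2.1 a) =
        ∏ a ∈ (Finset.univ.erase j).erase m, theta τ (c.2.1 j - c.2.1 a) := by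
      refine Finset.prod_congr rfl fun a ha => ?_
      simp [hm.symm, Finset.ne_of_mem_erase ha]
    rw [h₁]
    simp [hm.symm, ← sub_sub]
    ring
  simp only [hline]
  have h : HasDerivAt (fun t : ℂ => theta τ (c.2.1 j - c.2.1 m - t))
      (-deriv (theta τ) (c.2.1 j - c.2.1 m - 0)) 0 :=
    HasDerivAt.comp_const_sub _ _ (differentiable_theta hτ _).hasDerivAt
  refine ((h.inv (by simpa using hθ)).const_mul _).congr_deriv ?_
  have h₀ := hline 0
  rw [zero_smul, add_zero] at h₀
  rw [h₀, E1, sub_zero]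
  field_simp

theorem partialQShift_bJet (hτ : 0 < τ.im) (hνε : theta τ (ν * ε) ≠ 0) (m j : Fin N)
    {c : ShiftJet N} (hc : c ∈ regularJets N τ ε ν) :
    partialQShift (bJet τ ε ν j) m c =
      bJet τ ε ν j c * E1 τ (c.2.2 m - c.2.1 j - ν * ε) := by
  refine fderiv_eq_of_hasDerivAt_line (differentiableAt_bJet hτ hνε j hc) ?_
  have hneg : c.2.1 j - c.2.2 m + ν * ε = -(c.2.2 m - c.2.1 j - ν * ε) := by ring
  have hθ := hc.1 m j
  -- along this line only the factor `a = m` of the numerator moves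
  have hline : ∀ t : ℂ, bJet τ ε ν j (c + t • ((0, 0, Pi.single m 1) : ShiftJet N)) =
      (∏ a ∈ Finset.univ.erase m, theta τ (c.2.1 j - c.2.2 a + ν * ε)) / (theta τ (ν * ε) *
        ∏ a ∈ Finset.univ.erase j, theta τ (c.2.1 j - c.2.1 a)) * exp (-ε * c.1 j)
        * theta τ (c.2.1 j - c.2.2 m + ν * ε - t) := fun t => by
    rw [bJet, ← Finset.mul_prod_erase _ _ (Finset.mem_univ m)]
    have h₁ : ∏ a ∈ Finset.univ.erase m, theta τ
        ((c + t • ((0, 0, Pi.single m 1) : ShiftJet N)).2.1 j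
          - (c + t • ((0, 0, Pi.single m 1) : ShiftJet N)).2.2 a + ν * ε) =
        ∏ a ∈ Finset.univ.erase m, theta τ (c.2.1 j - c.2.2 a + ν * ε) := by
      refine Finset.prod_congr rfl fun a ha => ?_
      simp [Finset.ne_of_mem_erase ha]
    have h₂ : (c + t • ((0, 0, Pi.single m 1) : ShiftJet N)).2.1 j
          - (c + t • ((0, 0, Pi.single m 1) : ShiftJet N)).2.2 m + ν * ε =
        c.2.1 j - c.2.2 m + ν * ε - t := by
      simp
      ring
    rw [h₁, h₂]
    simp
    ring
  simp only [hline]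
  have h : HasDerivAt (fun t : ℂ => theta τ (c.2.1 j - c.2.2 m + ν * ε - t))
      (-deriv (theta τ) (c.2.1 j - c.2.2 m + ν * ε - 0)) 0 :=
    HasDerivAt.comp_const_sub _ _ (differentiable_theta hτ _).hasDerivAt
  refine (h.const_mul _).congr_deriv ?_
  have h₀ := hline 0
  rw [zero_smul, add_zero] at h₀
  rw [h₀, E1, sub_zero, hneg, deriv_theta_neg hτ, theta_neg hτ]
  field_simp

end LocalU

/-! ### Partial derivatives of the entries of `U` -/

section PartialDerivatives

variable {N : ℕ} {τ : ℂ} {ε : ℝ} {ν : ℂ}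

theorem partialP_uJet (hτ : 0 < τ.im) (hνε : theta τ (ν * ε) ≠ 0) {z : ℂ} (hz : theta τ z ≠ 0)
    (m i j : Fin N) {c : ShiftJet N} (hc : c ∈ regularJets N τ ε ν) :
    partialP (uJet τ ε ν z i j) m c = if m = j then -ε * uJet τ ε ν z i j c else 0 := by
  have h := partialP_bJet hτ hνε m j hc
  rw [partialP] at h ⊢
  rw [fderiv_uJet hτ hνε hz i j hc, h, uJet]
  split_ifs <;> simp
  ring

theorem partialQ_uJet_of_ne (hτ : 0 < τ.im) (hνε : theta τ (ν * ε) ≠ 0) {z : ℂ}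
    (hz : theta τ z ≠ 0) {m j : Fin N} (hm : m ≠ j) (i : Fin N) {c : ShiftJet N}
    (hc : c ∈ regularJets N τ ε ν) :
    partialQ (uJet τ ε ν z i j) m c = uJet τ ε ν z i j c * E1 τ (c.2.1 j - c.2.1 m) := by
  have h := partialQ_bJet_of_ne hτ hνε hm hc
  rw [partialQ] at h ⊢
  rw [fderiv_uJet hτ hνε hz i j hc, h, uJet]
  simp [hm.symm]
  ring

/-- The derivative of `b_j` in `q_j` is left as it stands: it cancels in the bracket. -/
theorem partialQ_uJet_self (hτ : 0 < τ.im) (hνε : theta τ (ν * ε) ≠ 0) {z : ℂ}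
    (hz : theta τ z ≠ 0) (i j : Fin N) {c : ShiftJet N} (hc : c ∈ regularJets N τ ε ν) :
    partialQ (uJet τ ε ν z i j) j c =
      phi τ z (c.2.2 i - c.2.1 j - ν * ε) * partialQ (bJet τ ε ν j) j c
        - deriv (phi τ z) (c.2.2 i - c.2.1 j - ν * ε) * bJet τ ε ν j c := by
  rw [partialQ, fderiv_uJet hτ hνε hz i j hc, partialQ]
  simp
  ring

theorem partialQShift_uJet (hτ : 0 < τ.im) (hνε : theta τ (ν * ε) ≠ 0) {z : ℂ}
    (hz : theta τ z ≠ 0) (m i j : Fin N) {c : ShiftJet N} (hc : c ∈ regularJets N τ ε ν) :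
    partialQShift (uJet τ ε ν z i j) m c =
      (if m = i then deriv (phi τ z) (c.2.2 i - c.2.1 j - ν * ε) * bJet τ ε ν j c else 0)
        + uJet τ ε ν z i j c * E1 τ (c.2.2 m - c.2.1 j - ν * ε) := by
  have h := partialQShift_bJet hτ hνε m j hc
  rw [partialQShift] at h ⊢
  rw [fderiv_uJet hτ hνε hz i j hc, h, uJet]
  rcases eq_or_ne m i with rfl | hm
  · simp
    ring
  · simp [hm, hm.symm]
    ring

end PartialDerivatives

/-! ### Entries of the matrix products -/

section MatrixEntries

variable {N : ℕ} {τ : ℂ} {ε : ℝ} {ν : ℂ} {P : PhaseSpace N}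

theorem kronecker_one_mul_apply (A : Matrix (Fin N) (Fin N) ℂ) (M : Mat2 N) (i k j l : Fin N) :
    ((A ⊗ₖ (1 : Matrix (Fin N) (Fin N) ℂ)) * M) (i, k) (j, l) =
      ∑ a, A i a * M (a, k) (j, l) := by
  simp [Matrix.mul_apply, Fintype.sum_prod_type, Matrix.one_apply]

theorem one_kronecker_mul_apply (A : Matrix (Fin N) (Fin N) ℂ) (M : Mat2 N) (i k j l : Fin N) :
    (((1 : Matrix (Fin N) (Fin N) ℂ) ⊗ₖ A) * M) (i, k) (j, l) =
      ∑ b, A k b * M (i, b) (j, l) := by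
  simp [Matrix.mul_apply, Fintype.sum_prod_type, Matrix.one_apply]

theorem mul_kronecker_one_apply (A : Matrix (Fin N) (Fin N) ℂ) (M : Mat2 N) (i k j l : Fin N) :
    (M * (A ⊗ₖ (1 : Matrix (Fin N) (Fin N) ℂ))) (i, k) (j, l) =
      ∑ a, M (i, k) (a, l) * A a j := by
  simp [Matrix.mul_apply, Fintype.sum_prod_type, Matrix.one_apply]

theorem mul_one_kronecker_apply (A : Matrix (Fin N) (Fin N) ℂ) (M : Mat2 N) (i k j l : Fin N) :
    (M * ((1 : Matrix (Fin N) (Fin N) ℂ) ⊗ₖ A)) (i, k) (j, l) =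
      ∑ b, M (i, k) (j, b) * A b l := by
  simp [Matrix.mul_apply, Fintype.sum_prod_type, Matrix.one_apply]

theorem sum_smul_single_kronecker_diag (c : Fin N → Fin N → ℂ) :
    ∑ i, ∑ j, c i j • (mE i i ⊗ₖ mE j j) =
      Matrix.diagonal fun a : Fin N × Fin N => c a.1 a.2 := by
  ext ⟨a, b⟩ ⟨j, l⟩
  simp [Matrix.sum_apply, Matrix.single_apply, Matrix.diagonal_apply, ite_and]
  grind

theorem U1sPlus_apply (z : ℂ) (x : Circ) (i k j l : Fin N) :
    U1sPlus τ ε ν z P x (i, k) (j, l) = if k = l then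
      (if k = i then dUmat τ ε ν z P x i j else 0)
        + Umat τ ε ν z P x i j * E1 τ (qShift ε ν P x k j) else 0 := by
  rw [U1sPlus, Matrix.add_apply, U1, uPlus, sum_smul_single_kronecker_diag,
    kronecker_one_mul_apply, U1s12]
  simp [Matrix.sum_apply, Matrix.single_apply, Matrix.diagonal_apply, ite_and]
  grind

theorem U2sMinus_apply (w : ℂ) (x : Circ) (i k j l : Fin N) :
    U2sMinus τ ε ν w P x (i, k) (j, l) = if i = j then
      (if i = k then dUmat τ ε ν w P x k l else 0)
        + Umat τ ε ν w P x k l * E1 τ (qShift ε ν P x i l) else 0 := by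
  rw [U2sMinus, Matrix.add_apply, U2, uMinus, sum_smul_single_kronecker_diag,
    one_kronecker_mul_apply, U2s21]
  simp [Matrix.sum_apply, Matrix.single_apply, Matrix.diagonal_apply, ite_and]
  grind

theorem r12_apply (ζ : ℂ) (x : Circ) (a b j l : Fin N) :
    r12 τ ζ P x (a, b) (j, l) =
      if j = l then (if a = j ∧ b = j then E1 τ ζ else 0)
      else (if a = l ∧ b = j then phi τ ζ (P.2 l x - P.2 j x) else 0)
        - (if a = j ∧ b = l then E1 τ (P.2 j x - P.2 l x) else 0) := by
  rw [r12]
  simp [Matrix.sum_apply, Matrix.single_apply, ite_and, Finset.sum_erase_eq_sub]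
  grind

theorem U1_mul_U2 (z w : ℂ) (x y : Circ) :
    U1 τ ε ν z P x * U2 τ ε ν w P y = Umat τ ε ν z P x ⊗ₖ Umat τ ε ν w P y := by
  rw [U1, U2, ← Matrix.mul_kronecker_mul, mul_one, one_mul]

theorem U2_mul_U1 (z w : ℂ) (x y : Circ) :
    U2 τ ε ν w P y * U1 τ ε ν z P x = Umat τ ε ν z P x ⊗ₖ Umat τ ε ν w P y := by
  rw [U1, U2, ← Matrix.mul_kronecker_mul, mul_one, one_mul]

theorem kronecker_mul_r12_apply (A B : Matrix (Fin N) (Fin N) ℂ) (ζ : ℂ) (x : Circ)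
    (i k j l : Fin N) :
    ((A ⊗ₖ B) * r12 τ ζ P x) (i, k) (j, l) =
      if j = l then A i j * B k j * E1 τ ζ
      else A i l * B k j * phi τ ζ (P.2 l x - P.2 j x)
        - A i j * B k l * E1 τ (P.2 j x - P.2 l x) := by
  simp only [Matrix.mul_apply, Fintype.sum_prod_type, Matrix.kroneckerMap_apply, r12_apply]
  split_ifs <;> simp [mul_sub, ite_and, Finset.sum_sub_distrib]

theorem r12_mul_kronecker_apply (A B : Matrix (Fin N) (Fin N) ℂ) (ζ : ℂ) (x : Circ)
    (i k j l : Fin N) :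
    (r12 τ ζ P x * (A ⊗ₖ B)) (i, k) (j, l) =
      if i = k then A i j * B i l * E1 τ ζ
      else A k j * B i l * phi τ ζ (P.2 i x - P.2 k x)
        - A i j * B k l * E1 τ (P.2 i x - P.2 k x) := by
  have h : ∀ a b : Fin N, r12 τ ζ P x (i, k) (a, b) =
      if i = k then (if a = i ∧ b = i then E1 τ ζ else 0)
      else (if a = k ∧ b = i then phi τ ζ (P.2 i x - P.2 k x) else 0)
        - (if a = i ∧ b = k then E1 τ (P.2 i x - P.2 k x) else 0) := fun a b => by
    rw [r12_apply]
    grind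
  simp only [Matrix.mul_apply, Fintype.sum_prod_type, Matrix.kroneckerMap_apply, h]
  split_ifs <;> simp [sub_mul, ite_and, Finset.sum_sub_distrib] <;> ring

end MatrixEntries

/-! ### The coefficients of the delta functions -/

section PointwiseIdentities

variable {N : ℕ} {τ : ℂ} {ε : ℝ} {ν : ℂ} {P : PhaseSpace N}

/-- The coefficient of `δ(x - y + ε)`. -/
theorem sum_partialP_mul_partialQShift (hτ : 0 < τ.im) (hνε : theta τ (ν * ε) ≠ 0) {z w : ℂ}
    (hz : theta τ z ≠ 0) (hw : theta τ w ≠ 0)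
    (hP : ∀ x, shiftJet ε P x ∈ regularJets N τ ε ν) (x y : Circ) (i j k l : Fin N) :
    ∑ m, partialP (uJet τ ε ν z i j) m (shiftJet ε P x)
        * partialQShift (uJet τ ε ν w k l) m (shiftJet ε P y) =
      -ε * (U1 τ ε ν z P x * U2sMinus τ ε ν w P y) (i, k) (j, l) := by
  simp only [partialP_uJet hτ hνε hz _ _ _ (hP x), partialQShift_uJet hτ hνε hw _ _ _ (hP y)]
  rw [U1, kronecker_one_mul_apply]
  simp only [U2sMinus_apply, ite_mul, zero_mul, mul_ite, mul_zero, Finset.sum_ite_eq',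
    Finset.mem_univ, if_true, Umat_eq_uJet]
  rw [mul_assoc]
  rfl

/-- The coefficient of `δ(x - y - ε)`. -/
theorem sum_partialQShift_mul_partialP (hτ : 0 < τ.im) (hνε : theta τ (ν * ε) ≠ 0) {z w : ℂ}
    (hz : theta τ z ≠ 0) (hw : theta τ w ≠ 0)
    (hP : ∀ x, shiftJet ε P x ∈ regularJets N τ ε ν) (x y : Circ) (i j k l : Fin N) :
    ∑ m, partialQShift (uJet τ ε ν z i j) m (shiftJet ε P x)
        * partialP (uJet τ ε ν w k l) m (shiftJet ε P y) =
      -ε * (U2 τ ε ν w P y * U1sPlus τ ε ν z P x) (i, k) (j, l) := by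
  simp only [partialP_uJet hτ hνε hw _ _ _ (hP y), partialQShift_uJet hτ hνε hz _ _ _ (hP x)]
  rw [U2, one_kronecker_mul_apply]
  simp only [U1sPlus_apply, mul_ite, mul_zero, Finset.sum_ite_eq',
    Finset.mem_univ, if_true, Umat_eq_uJet]
  rw [mul_comm, mul_assoc]
  rfl

/-- The coefficient of `δ(x - y)`. The cases are `j = l` or not and `i = k` or not; with
`j = l` and `i = k` the identity is trivial, with just one of these equalities it is
`deriv_phi_mul_phi_sub`, and with neither of them `phi_mul_phi_mul_E1`. -/
theorem sum_partialP_mul_partialQ_sub (hτ : 0 < τ.im) (hνε : theta τ (ν * ε) ≠ 0) {z w : ℂ}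
    (hz : theta τ z ≠ 0) (hw : theta τ w ≠ 0) (hzw : theta τ (z - w) ≠ 0)
    (hP : ∀ x, shiftJet ε P x ∈ regularJets N τ ε ν) (x : Circ) (i j k l : Fin N) :
    ∑ m, (partialP (uJet τ ε ν z i j) m (shiftJet ε P x)
        * partialQ (uJet τ ε ν w k l) m (shiftJet ε P x)
        - partialQ (uJet τ ε ν z i j) m (shiftJet ε P x)
        * partialP (uJet τ ε ν w k l) m (shiftJet ε P x)) =
      -ε * (U1 τ ε ν z P x * U2 τ ε ν w P x * r12 τ (z - w) P x
          - r12 τ (z - w) P (x - (ε : Circ)) * U1 τ ε ν z P x * U2 τ ε ν w P x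
          + U1sPlus τ ε ν z P x * U2 τ ε ν w P x
          - U2sMinus τ ε ν w P x * U1 τ ε ν z P x) (i, k) (j, l) := by
  have hc := hP x
  rw [mul_assoc (r12 _ _ _ _), U1_mul_U2, Matrix.sub_apply, Matrix.add_apply, Matrix.sub_apply,
    kronecker_mul_r12_apply, r12_mul_kronecker_apply, U2, mul_one_kronecker_apply, U1,
    mul_kronecker_one_apply]
  simp only [U1sPlus_apply, U2sMinus_apply, Finset.sum_sub_distrib,
    partialP_uJet hτ hνε hz _ _ _ hc, partialP_uJet hτ hνε hw _ _ _ hc, ite_mul, mul_ite, zero_mul,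
    mul_zero, Finset.sum_ite_eq, Finset.sum_ite_eq', Finset.mem_univ, if_true]
  have hq : ∀ a b, a ≠ b → theta τ (P.2 a x - P.2 b x) ≠ 0 := hc.2
  have hQ : ∀ a b, a ≠ b → theta τ (P.2 a (x - (ε : Circ)) - P.2 b (x - (ε : Circ))) ≠ 0 :=
    (hP (x - (ε : Circ))).2
  have hs : ∀ a b, theta τ (qShift ε ν P x a b) ≠ 0 := hc.1
  have hu : ∀ ζ a b, uJet τ ε ν ζ a b (shiftJet ε P x) =
    phi τ ζ (qShift ε ν P x a b) * bField τ ε ν P x b := fun _ _ _ => rfl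
  have hU : ∀ ζ a b, Umat τ ε ν ζ P x a b =
    phi τ ζ (qShift ε ν P x a b) * bField τ ε ν P x b := fun _ _ _ => rfl
  have hdU : ∀ ζ a b, dUmat τ ε ν ζ P x a b =
    deriv (phi τ ζ) (qShift ε ν P x a b) * bField τ ε ν P x b := fun _ _ _ => rfl
  have hself : ∀ {ζ}, theta τ ζ ≠ 0 → ∀ a b, partialQ (uJet τ ε ν ζ a b) b (shiftJet ε P x) =
      phi τ ζ (qShift ε ν P x a b) * partialQ (bJet τ ε ν b) b (shiftJet ε P x)
        - deriv (phi τ ζ) (qShift ε ν P x a b) * bField τ ε ν P x b :=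
    fun hζ a b => partialQ_uJet_self hτ hνε hζ a b hc
  have hne : ∀ {ζ}, theta τ ζ ≠ 0 → ∀ {m b}, m ≠ b → ∀ a,
      partialQ (uJet τ ε ν ζ a b) m (shiftJet ε P x) =
      phi τ ζ (qShift ε ν P x a b) * bField τ ε ν P x b * E1 τ (P.2 b x - P.2 m x) :=
    fun hζ _ _ hm a => partialQ_uJet_of_ne hτ hνε hζ hm a hc
  have hrow : ∀ a b m, qShift ε ν P x a m - qShift ε ν P x b m =
      P.2 a (x - (ε : Circ)) - P.2 b (x - (ε : Circ)) := fun a b m => by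
    simp only [qShift]; ring
  have hcol : ∀ a b m, qShift ε ν P x m a - qShift ε ν P x m b = P.2 b x - P.2 a x :=
    fun a b m => by simp only [qShift]; ring
  simp only [hu, hU, hdU]
  rcases eq_or_ne j l with rfl | hjl
  · rw [hself hz, hself hw, if_pos rfl]
    rcases eq_or_ne i k with rfl | hik
    · simp only [if_true]
      ring
    · have h := deriv_phi_mul_phi_sub hτ hz hw hzw (hs i j) (hs k j)
        (by rw [hrow]; exact hQ i k hik)
      rw [hrow] at h
      simp only [if_neg hik, if_neg hik.symm]
      linear_combination (-ε * bField τ ε ν P x j ^ 2) * h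
  · rw [hne hz hjl.symm, hne hw hjl, if_neg hjl]
    have hE := E1_neg hτ (P.2 j x - P.2 l x)
    rw [neg_sub] at hE
    rcases eq_or_ne i k with rfl | hik
    · have h := deriv_phi_mul_phi_sub hτ hz hw hzw (hs i j) (hs i l)
        (by rw [hcol]; exact hq l j hjl.symm)
      rw [hcol] at h
      simp only [if_true]
      rw [hE] at h ⊢
      linear_combination (ε * bField τ ε ν P x j * bField τ ε ν P x l) * h
    · have h := phi_mul_phi_mul_E1 hτ (A := qShift ε ν P x i j) (B := qShift ε ν P x k l)
        (C := qShift ε ν P x i l) (D := qShift ε ν P x k j) hz hw hzw (by simp only [qShift]; ring)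
        (hs i j) (hs k l) (hs i l) (hs k j) (by rw [hcol]; exact hq l j hjl.symm)
        (by rw [hrow]; exact hQ i k hik)
      rw [hcol, hrow] at h
      simp only [if_neg hik, if_neg hik.symm]
      rw [hE] at h ⊢
      linear_combination (-ε * bField τ ε ν P x j * bField τ ε ν P x l) * h

end PointwiseIdentities

/-! ### The quadratic bracket -/

/-- The second, unconditional form of the bracket; where `U(z,x)` and `U(w,x)` are invertible the
first form follows from it by matrix algebra. -/
theorem hasTensorBracket_Umat {N : ℕ} {τ : ℂ} (hτ : 0 < τ.im) {ε : ℝ} {ν : ℂ} {P : PhaseSpace N}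
    {z w : ℂ} (hνε : theta τ (ν * ε) ≠ 0) (hz : theta τ z ≠ 0) (hw : theta τ w ≠ 0)
    (hzw : theta τ (z - w) ≠ 0) (hP : ∀ x, shiftJet ε P x ∈ regularJets N τ ε ν) :
    HasTensorBracket (Umat τ ε ν z) (Umat τ ε ν w) P
      (-(ε : ℂ) • deltaDist 0 (fun x _ =>
          U1 τ ε ν z P x * U2 τ ε ν w P x * r12 τ (z - w) P x
          - r12 τ (z - w) P (x - (ε : Circ)) * U1 τ ε ν z P x * U2 τ ε ν w P x
          + U1sPlus τ ε ν z P x * U2 τ ε ν w P x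
          - U2sMinus τ ε ν w P x * U1 τ ε ν z P x)
        - (ε : ℂ) • deltaDist ε (fun x y => U1 τ ε ν z P x * U2sMinus τ ε ν w P y)
        + (ε : ℂ) • deltaDist (-ε) (fun x y => U2 τ ε ν w P y * U1sPlus τ ε ν z P x)) := by
  intro f g i j k l
  have h := hasPoissonBracket_smear (isOpen_regularJets hτ) (contDiffOn_uJet hτ hνε hz i j)
    (contDiffOn_uJet hτ hνε hw k l) hP f g
  simp only [sum_partialP_mul_partialQ_sub hτ hνε hz hw hzw hP,
    sum_partialP_mul_partialQShift hτ hνε hz hw hP,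
    sum_partialQShift_mul_partialP hτ hνε hz hw hP, mul_left_comm _ (-(ε : ℂ)),
    integral_const_mul] at h
  simp only [Umat_eq_uJet]
  convert h using 1
  simp only [Pi.add_apply, Pi.sub_apply, Pi.smul_apply, Matrix.add_apply, Matrix.sub_apply,
    Matrix.smul_apply, deltaDist, Matrix.of_apply, smul_eq_mul, AddCircle.coe_zero, add_zero,
    AddCircle.coe_neg, ← sub_eq_add_neg]
  ring

theorem mainTheorem5 {N : ℕ} (τ : ℂ) (hτ : 0 < τ.im) (ε : ℝ) (ν : ℂ) (P : PhaseSpace N) (z w : ℂ)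
    (hνε : theta τ (ν * ε) ≠ 0)
    (hq : ∀ (x : Circ) (i j : Fin N), i ≠ j → theta τ (P.2 i x - P.2 j x) ≠ 0)
    (hqε : ∀ (x : Circ) (i j : Fin N),
      theta τ (P.2 i (x - (ε : Circ)) - P.2 j x - ν * ε) ≠ 0)
    (hz : theta τ z ≠ 0) (hw : theta τ w ≠ 0) (hzw : theta τ (z - w) ≠ 0) :
    -- the quadratic relation, where the matrices `s₁₂` and `s₂₁` are defined
    ((∀ x : Circ, IsUnit (Umat τ ε ν z P x).det) → (∀ x : Circ, IsUnit (Umat τ ε ν w P x).det) →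
      (∀ x : Circ, U1 τ ε ν z P x * s12 τ ε ν z P x = U1s12 τ ε ν z P x ∧
        U2 τ ε ν w P x * s21 τ ε ν w P x = U2s21 τ ε ν w P x) ∧
      HasTensorBracket (Umat τ ε ν z) (Umat τ ε ν w) P
        (-(ε : ℂ) • deltaDist 0 (fun x _ =>
            U1 τ ε ν z P x * U2 τ ε ν w P x * r12 τ (z - w) P x
            - r12 τ (z - w) P (x - (ε : Circ)) * U1 τ ε ν z P x * U2 τ ε ν w P x
            + U1 τ ε ν z P x * sPlus τ ε ν z P x * U2 τ ε ν w P x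
            - U2 τ ε ν w P x * sMinus τ ε ν w P x * U1 τ ε ν z P x)
          - (ε : ℂ) • deltaDist ε (fun x y =>
            U1 τ ε ν z P x * U2 τ ε ν w P y * sMinus τ ε ν w P y)
          + (ε : ℂ) • deltaDist (-ε) (fun x y =>
            U1 τ ε ν z P x * U2 τ ε ν w P y * sPlus τ ε ν z P x))) ∧
    -- the same relation for all `z` and `w`, through the products `U₁ s₁₂⁺` and `U₂ s₁₂⁻`
    HasTensorBracket (Umat τ ε ν z) (Umat τ ε ν w) P
      (-(ε : ℂ) • deltaDist 0 (fun x _ =>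
          U1 τ ε ν z P x * U2 τ ε ν w P x * r12 τ (z - w) P x
          - r12 τ (z - w) P (x - (ε : Circ)) * U1 τ ε ν z P x * U2 τ ε ν w P x
          + U1sPlus τ ε ν z P x * U2 τ ε ν w P x
          - U2sMinus τ ε ν w P x * U1 τ ε ν z P x)
        - (ε : ℂ) • deltaDist ε (fun x y => U1 τ ε ν z P x * U2sMinus τ ε ν w P y)
        + (ε : ℂ) • deltaDist (-ε) (fun x y => U2 τ ε ν w P y * U1sPlus τ ε ν z P x)) := by
  have hP : ∀ x, shiftJet ε P x ∈ regularJets N τ ε ν := fun x => ⟨hqε x, hq x⟩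
  have key := hasTensorBracket_Umat hτ hνε hz hw hzw hP
  refine ⟨fun hUz hUw => ?_, key⟩
  have h₁ : ∀ x, U1 τ ε ν z P x * s12 τ ε ν z P x = U1s12 τ ε ν z P x := fun x => by
    rw [s12]
    refine Matrix.mul_nonsing_inv_cancel_left _ _ ?_
    rw [U1, Matrix.det_kronecker, Matrix.det_one, one_pow, mul_one]
    exact (hUz x).pow _
  have h₂ : ∀ x, U2 τ ε ν w P x * s21 τ ε ν w P x = U2s21 τ ε ν w P x := fun x => by
    rw [s21]
    refine Matrix.mul_nonsing_inv_cancel_left _ _ ?_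
    rw [U2, Matrix.det_kronecker, Matrix.det_one, one_pow, one_mul]
    exact (hUw x).pow _
  have h₃ : ∀ x, U1 τ ε ν z P x * sPlus τ ε ν z P x = U1sPlus τ ε ν z P x := fun x => by
    rw [sPlus, mul_add, h₁, U1sPlus]
  have h₄ : ∀ x, U2 τ ε ν w P x * sMinus τ ε ν w P x = U2sMinus τ ε ν w P x := fun x => by
    rw [sMinus, mul_add, h₂, U2sMinus]
  have h₅ : ∀ x y, U1 τ ε ν z P x * U2 τ ε ν w P y * sMinus τ ε ν w P y =
      U1 τ ε ν z P x * U2sMinus τ ε ν w P y := fun x y => by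
    rw [mul_assoc, h₄]
  have h₆ : ∀ x y, U1 τ ε ν z P x * U2 τ ε ν w P y * sPlus τ ε ν z P x =
      U2 τ ε ν w P y * U1sPlus τ ε ν z P x := fun x y => by
    rw [U1_mul_U2, ← U2_mul_U1, mul_assoc, h₃]
  refine ⟨fun x => ⟨h₁ x, h₂ x⟩, ?_⟩
  simpa only [h₃, h₄, h₅, h₆] using key
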